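/- An order-enriched category is a category whose hom-sets are partially ordered such that composition is monotone in both variables. Let $\mathcal X$ be an order-enriched category with a proper factorization system $(\mathcal E,\mathcal M)$, i.e. every $e\in\mathcal E$ is an epimorphism and every $m\in\mathcal M$ is an order-monomorphism ($mf\le mg$ implies $f\le g$). Assume that $\mathcal X$ is locally ranked: it has all small weighted ($\mathsf{Pos}$-enriched) colimits, every object has, up to isomorphism, only a set of quotients in $\mathcal E$, and every object $A$ has a rank, i.e. there is an infinite regular cardinal $\lambda$ such that whenever $X$ is the union of a $\lambda$-chain $m_i\colon M_i\to X$ $(i<\lambda)$ of subobjects in $\mathcal M$, every morphism $A\to X$ factorizes through some $m_i$. For $h\colon A\to A'$ and $f\colon A\to X$ let $\mathrm{Lan}_h f\colon A'\to X$ denote, if it exists, the least morphism $l$ with $f\le l\cdot h$. An object $X$ is weakly left Kan-injective with respect to $h$ if $\mathrm{Lan}_h f$ exists for every $f\colon A\to X$, and left Kan-injective if moreover $(\mathrm{Lan}_h f)\cdot h=f$ for all $f$. A morphism $p\colon X\to Y$ between (weakly) left Kan-injective objects is (weakly) left Kan-injective if $p\cdot \mathrm{Lan}_h f=\mathrm{Lan}_h(pf)$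 for all $f\colon A\to X$. For a class $\mathcal H$ of morphisms let $\mathrm{LInj}(\mathcal H)$, respectively $\mathrm{wLInj}(\mathcal H)$, be the (not necessarily full) subcategory of $\mathcal X$ of all objects and all morphisms that are left Kan-injective, respectively weakly left Kan-injective, with respect to every member of $\mathcal H$. Theorem. For every set $\mathcal H$ of morphisms of a locally ranked order-enriched category $\mathcal X$ there exists a class $\overline{\mathcal H}$ of morphisms of $\mathcal X$ such that $$\mathrm{wLInj}(\mathcal H)=\mathrm{LInj}(\overline{\mathcal H}),$$ i.e. the two subcategories have the same objects and the same morphisms. -/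

import Mathlib

open CategoryTheory

universe v u v' u'

namespace KanInjectivity

/-- An order-enriched category: every hom-set is partially ordered and composition is monotone
in both variables. -/
class OrderEnriched (C : Type u) [Category.{v} C] where
  homOrder (X Y : C) : PartialOrder (X ⟶ Y)
  comp_le_comp {X Y Z : C} {f f' : X ⟶ Y} {g g' : Y ⟶ Z} :
    f ≤ f' → g ≤ g' → f ≫ g ≤ f' ≫ g'

attribute [reducible, instance] OrderEnriched.homOrder

/-- Locally monotone functors between order-enriched categories. -/
class LocallyMonotone {C : Type u} [Category.{v} C] [OrderEnriched C]
    {D : Type u'} [Category.{v'} D] [OrderEnriched D] (F : C ⥤ D) : Prop where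
  map_le_map {X Y : C} {f g : X ⟶ Y} : f ≤ g → F.map f ≤ F.map g

/-- The opposite category carries the same order on hom-sets. -/
instance (C : Type u) [Category.{v} C] [OrderEnriched C] : OrderEnriched Cᵒᵖ where
  homOrder X Y := PartialOrder.lift (fun f : X ⟶ Y => f.unop) Quiver.Hom.unop_inj
  comp_le_comp hf hg := OrderEnriched.comp_le_comp (C := C) hg hf

/-- The category of posets, with the pointwise order on monotone maps. -/
instance : OrderEnriched PartOrd.{v} where
  homOrder X Y := PartialOrder.lift (fun f : X ⟶ Y => f.hom) (fun _ _ h => PartOrd.hom_ext h)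
  comp_le_comp {_ _ _ _ f' g _} hf hg := fun x =>
    (g.hom.monotone (hf x)).trans (hg (f'.hom x))

/-- Natural transformations are ordered objectwise. -/
instance (D : Type u') [Category.{v'} D] (C : Type u) [Category.{v} C] [OrderEnriched C] :
    OrderEnriched (D ⥤ C) where
  homOrder F G := PartialOrder.lift (fun α : F ⟶ G => α.app) (fun _ _ h => NatTrans.ext h)
  comp_le_comp hf hg := fun d => OrderEnriched.comp_le_comp (hf d) (hg d)

section

variable {C : Type u} [Category.{v} C] [OrderEnriched C]

/-- An order-monomorphism: `f ≫ i ≤ g ≫ i` implies `f ≤ g`. -/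
def IsOrderMono {I X : C} (i : I ⟶ X) : Prop :=
  ∀ ⦃J : C⦄ (f g : J ⟶ I), f ≫ i ≤ g ≫ i → f ≤ g

/-! ### Weighted colimits -/

/-- The functor `X(F -, X) : Dᵒᵖ ⥤ Pos`. -/
def homInto {D : Type u'} [Category.{v'} D] (F : D ⥤ C) (X : C) : Dᵒᵖ ⥤ PartOrd.{v} where
  obj d := PartOrd.of (F.obj d.unop ⟶ X)
  map k := PartOrd.ofHom
    ⟨fun g => F.map k.unop ≫ g, fun _ _ h => OrderEnriched.comp_le_comp le_rfl h⟩
  map_id d := by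
    ext g
    exact (congrArg (· ≫ g) (F.map_id d.unop)).trans (Category.id_comp g)
  map_comp k l := by
    ext g
    exact (congrArg (· ≫ g) (F.map_comp l.unop k.unop)).trans (Category.assoc _ _ g)

/-- Postcomposition with `t : X ⟶ Y`, as a natural transformation `X(F -, X) ⟶ X(F -, Y)`. -/
def homIntoMap {D : Type u'} [Category.{v'} D] (F : D ⥤ C) {X Y : C} (t : X ⟶ Y) :
    homInto F X ⟶ homInto F Y where
  app d := PartOrd.ofHom
    ⟨fun g : F.obj d.unop ⟶ X => g ≫ t, fun _ _ h => OrderEnriched.comp_le_comp h le_rfl⟩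
  naturality d e k := by
    ext g
    exact Category.assoc (F.map k.unop) g t

/-- A colimit of `F` weighted by `W`: an object `pt` together with an isomorphism of posets
`X(pt, X) ≅ [Dᵒᵖ, Pos](W, X(F -, X))`, natural in `X`. -/
structure WeightedColimit {D : Type u'} [Category.{v'} D] (F : D ⥤ C)
    (W : Dᵒᵖ ⥤ PartOrd.{v}) where
  pt : C
  equiv (X : C) : (pt ⟶ X) ≃o (W ⟶ homInto F X)
  naturality {X Y : C} (g : pt ⟶ X) (t : X ⟶ Y) :
    equiv Y (g ≫ t) = equiv X g ≫ homIntoMap F t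

variable (C) in
/-- All colimits of locally monotone functors from small order-enriched categories, weighted by
locally monotone weights, exist. -/
def HasWeightedColimits : Prop :=
  ∀ (D : Type v) [SmallCategory D] [OrderEnriched D] (F : D ⥤ C) [LocallyMonotone F]
    (W : Dᵒᵖ ⥤ PartOrd.{v}) [LocallyMonotone W], Nonempty (WeightedColimit F W)

/-! ### Locally ranked categories -/

/-- A factorization system `(E, M)`: both classes are closed under composition with isomorphisms,
every morphism is an `E`-morphism followed by an `M`-morphism, and every commutative square with
an `E`-morphism on the left and an `M`-morphism on the right has a unique diagonal. -/
structure IsFactorizationSystem (E M : MorphismProperty C) : Prop where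
  respectsIso_left : E.RespectsIso
  respectsIso_right : M.RespectsIso
  factors {X Y : C} (f : X ⟶ Y) :
    ∃ (Z : C) (e : X ⟶ Z) (m : Z ⟶ Y), E e ∧ M m ∧ e ≫ m = f
  diagonal {A B X Y : C} {e : A ⟶ B} {m : X ⟶ Y} (f : A ⟶ X) (g : B ⟶ Y) :
    E e → M m → f ≫ m = e ≫ g → ∃! d : B ⟶ X, e ≫ d = f ∧ d ≫ m = g

/-- A factorization system of an order-enriched category is proper if `E` consists of
epimorphisms and `M` of order-monomorphisms. -/
structure IsProperFactorizationSystem (E M : MorphismProperty C) : Prop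
    extends IsFactorizationSystem E M where
  epi {X Y : C} (e : X ⟶ Y) : E e → Epi e
  orderMono {X Y : C} (m : X ⟶ Y) : M m → IsOrderMono m

/-- `E`-cowellpoweredness: up to isomorphism, every object has only a (small) set of quotients
in `E`. -/
def IsCowellpowered (E : MorphismProperty C) : Prop :=
  ∀ X : C, ∃ (ι : Type v) (Q : ι → C) (q : ∀ i, X ⟶ Q i), (∀ i, E (q i)) ∧
    ∀ (Y : C) (e : X ⟶ Y), E e → ∃ (i : ι) (φ : Q i ≅ Y), q i ≫ φ.hom = e

/-- The family `m i : S i ⟶ X`, indexed by the ordinals below `lam`, is an increasing chain of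
`M`-subobjects of `X`. -/
def IsSubobjectChain (M : MorphismProperty C) (lam : Cardinal.{v}) {X : C}
    (S : lam.ord.ToType → C) (m : ∀ i, S i ⟶ X) : Prop :=
  (∀ i, M (m i)) ∧ ∀ i j, i ≤ j → ∃ k : S i ⟶ S j, k ≫ m j = m i

/-- The object `X` is the union of its `M`-subobjects `m i : S i ⟶ X`: no `M`-subobject of `X`
other than `X` itself contains them all. -/
def IsUnion (M : MorphismProperty C) {ι : Type v} {X : C} (S : ι → C) (m : ∀ i, S i ⟶ X) : Prop :=
  ∀ ⦃N : C⦄ (n : N ⟶ X), M n → (∀ i, ∃ k : S i ⟶ N, k ≫ n = m i) → IsIso n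

/-- The object `A` has rank `lam`: whenever `X` is the union of a `lam`-chain of `M`-subobjects,
every morphism `A ⟶ X` factors through a member of the chain. -/
def HasRank (M : MorphismProperty C) (A : C) (lam : Cardinal.{v}) : Prop :=
  ∀ ⦃X : C⦄ (S : lam.ord.ToType → C) (m : ∀ i, S i ⟶ X),
    IsSubobjectChain M lam S m → IsUnion M S m →
      ∀ p : A ⟶ X, ∃ (i : lam.ord.ToType) (p' : A ⟶ S i), p' ≫ m i = p

/-- An order-enriched category with a proper factorization system `(E, M)` is locally ranked if it
has weighted colimits, is `E`-cowellpowered, and every object has a rank, which is an infinite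
regular cardinal. -/
structure IsLocallyRanked (E M : MorphismProperty C) : Prop where
  proper : IsProperFactorizationSystem E M
  weightedColimits : HasWeightedColimits C
  cowellpowered : IsCowellpowered E
  rank (A : C) : ∃ lam : Cardinal.{v}, lam.IsRegular ∧ HasRank M A lam

/-! ### Kan-injectivity -/

/-- `l` is the left Kan extension of `f` along `h`, i.e. the least `l` with `f ≤ h ≫ l`. -/
def IsLan {A A' X : C} (h : A ⟶ A') (f : A ⟶ X) (l : A' ⟶ X) : Prop :=
  f ≤ h ≫ l ∧ ∀ g : A' ⟶ X, f ≤ h ≫ g → l ≤ g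

/-- The object `X` is left Kan-injective with respect to `h`. -/
def LeftKanInjObj {A A' : C} (h : A ⟶ A') (X : C) : Prop :=
  ∀ f : A ⟶ X, ∃ l : A' ⟶ X, IsLan h f l ∧ h ≫ l = f

/-- The morphism `p` is left Kan-injective with respect to `h`. -/
def LeftKanInjHom {A A' : C} (h : A ⟶ A') {X Y : C} (p : X ⟶ Y) : Prop :=
  LeftKanInjObj h X ∧ LeftKanInjObj h Y ∧
    ∀ (f : A ⟶ X) (l : A' ⟶ X), IsLan h f l → IsLan h (f ≫ p) (l ≫ p)

/-- The object `X` is weakly left Kan-injective with respect to `h`. -/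
def WeakLeftKanInjObj {A A' : C} (h : A ⟶ A') (X : C) : Prop :=
  ∀ f : A ⟶ X, ∃ l : A' ⟶ X, IsLan h f l

/-- The morphism `p` is weakly left Kan-injective with respect to `h`. -/
def WeakLeftKanInjHom {A A' : C} (h : A ⟶ A') {X Y : C} (p : X ⟶ Y) : Prop :=
  WeakLeftKanInjObj h X ∧ WeakLeftKanInjObj h Y ∧
    ∀ (f : A ⟶ X) (l : A' ⟶ X), IsLan h f l → IsLan h (f ≫ p) (l ≫ p)

end

/-- A (not necessarily full) subcategory: a class of objects and a class of morphisms between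
them, containing the identities of its objects and closed under composition. -/
@[ext]
structure Subcategory (C : Type u) [Category.{v} C] where
  obj : ObjectProperty C
  hom : MorphismProperty C
  source {X Y : C} (f : X ⟶ Y) : hom f → obj X
  target {X Y : C} (f : X ⟶ Y) : hom f → obj Y
  id_mem (X : C) : obj X → hom (𝟙 X)
  comp_mem {X Y Z : C} (f : X ⟶ Y) (g : Y ⟶ Z) : hom f → hom g → hom (f ≫ g)

section

variable {C : Type u} [Category.{v} C] [OrderEnriched C]

/-- The subcategory of all objects and all morphisms that are left Kan-injective with respect to
every member of `H`. -/
def LInj (H : MorphismProperty C) : Subcategory C where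
  obj X := ∀ ⦃A A' : C⦄ (h : A ⟶ A'), H h → LeftKanInjObj h X
  hom X Y p := ∀ ⦃A A' : C⦄ (h : A ⟶ A'), H h → LeftKanInjHom h p
  source _ hf _ _ h hh := (hf h hh).1
  target _ hf _ _ h hh := (hf h hh).2.1
  id_mem X hX _ _ h hh := ⟨hX h hh, hX h hh, fun f l hl => by simpa using hl⟩
  comp_mem f g hf hg _ _ h hh := ⟨(hf h hh).1, (hg h hh).2.1, fun k l hl => by
    simpa using (hg h hh).2.2 _ _ ((hf h hh).2.2 k l hl)⟩

/-- The subcategory of all objects and all morphisms that are weakly left Kan-injective with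
respect to every member of `H`. -/
def wLInj (H : MorphismProperty C) : Subcategory C where
  obj X := ∀ ⦃A A' : C⦄ (h : A ⟶ A'), H h → WeakLeftKanInjObj h X
  hom X Y p := ∀ ⦃A A' : C⦄ (h : A ⟶ A'), H h → WeakLeftKanInjHom h p
  source _ hf _ _ h hh := (hf h hh).1
  target _ hf _ _ h hh := (hf h hh).2.1
  id_mem X hX _ _ h hh := ⟨hX h hh, hX h hh, fun f l hl => by simpa using hl⟩
  comp_mem f g hf hg _ _ h hh := ⟨(hf h hh).1, (hg h hh).2.1, fun k l hl => by
    simpa using (hg h hh).2.2 _ _ ((hf h hh).2.2 k l hl)⟩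

end

end KanInjectivity

/-!
Let `K = wLInj H`, and let `kanClosure K` consist of all morphisms with respect to which every
object and every morphism of `K` is left Kan-injective. Then `wLInj H = LInj (kanClosure K)`.
The inclusion `⊆` is clear. For the converse it suffices to find, for every object `X`, a morphism
`r : X ⟶ R` in `kanClosure K` with `R` in `K` and such that the left Kan extensions along `r` of
morphisms into objects of `K` belong to `K`: if `X` is left Kan-injective with respect to `r`, it
is a retract of `R`, and left Kan extensions along members of `H` can be computed in `R`
(`IsLan.of_retract`); the same applies to morphisms.

Such an `r` is a suitable `Extension K X`: a morphism `r : X ⟶ Y` in `kanClosure K` for which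
the left Kan extensions along `r` of all morphisms from `X` into `K` are jointly order-monic.
Because of this separation property, extensions form a preorder, and every inequality that is
needed can be tested after composing with the left Kan extensions into `K`. In particular, if every
`f : A ⟶ Y` has a "formal" left Kan extension `l : A' ⟶ Y`, that is, one that becomes a left Kan
extension after composing with morphisms into `K`, then `Y` is in `K`.

Extensions are produced by `IsLocallyRanked.exists_generated`: a small family of objects with a
class of compatible morphisms into a class of targets generates an object separated by those
targets, namely the largest `E`-quotient of the coproduct through which all the morphisms factor.
This yields small unions of extensions (`Extension.exists_union`) and one-step completions
(`Extension.exists_closure`).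

The iteration of these steps converges although the connecting morphisms of the chain are not in
`M`. Since an object has only a set of quotients in `E`, every extension `Y` lies below a `Z`
that already contains the image of `Y` in any larger extension (`Extension.exists_stable`). So if
a morphism into the union of the chain factors through the image of one of its members, it
factors through a later member. The ranks of the domains of the members of `H` need not have
a common value; what is used is a rank of the coproduct of those domains that admit some morphism
into an extension (`Extension.exists_closed`).
-/

namespace KanInjectivity

/-! ### Coproducts and coinserters from weighted colimits -/

section

variable {C : Type u} [Category.{v} C] [OrderEnriched C]

theorem comp_le_comp_left {X Y Z : C} (f : X ⟶ Y) {g g' : Y ⟶ Z} (hg : g ≤ g') :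
    f ≫ g ≤ f ≫ g' :=
  OrderEnriched.comp_le_comp le_rfl hg

theorem comp_le_comp_right {X Y Z : C} {f f' : X ⟶ Y} (hf : f ≤ f') (g : Y ⟶ Z) :
    f ≫ g ≤ f' ≫ g :=
  OrderEnriched.comp_le_comp hf le_rfl

/-- Every category is order-enriched by equality. -/
@[reducible] def OrderEnriched.discrete (D : Type u') [Category.{v'} D] : OrderEnriched D where
  homOrder _ _ :=
    { le := Eq
      le_refl := fun _ => rfl
      le_trans := fun _ _ _ => Eq.trans
      le_antisymm := fun _ _ h _ => h }
  comp_le_comp := by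
    rintro _ _ _ _ _ _ _ rfl rfl
    rfl

/-- Over an ordinary small category, every functor and every weight is locally monotone for the
discrete order, so weighted colimits over ordinary diagrams exist. -/
theorem HasWeightedColimits.nonempty_weightedColimit (hC : HasWeightedColimits C) {D : Type v}
    [SmallCategory D] (F : D ⥤ C) (W : Dᵒᵖ ⥤ PartOrd.{v}) : Nonempty (WeightedColimit F W) := by
  let := OrderEnriched.discrete D
  have : LocallyMonotone F := ⟨fun {_ _ f g} (h : f = g) => by rw [h]⟩
  have : LocallyMonotone W :=
    ⟨fun {_ _ f g} (h : f.unop = g.unop) => by rw [Quiver.Hom.unop_inj h]⟩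
  exact hC D F W

namespace WeightedColimit

variable {D : Type u'} [Category.{v'} D] {F : D ⥤ C} {W : Dᵒᵖ ⥤ PartOrd.{v}}

/-- The coprojections of a weighted colimit, obtained from the identity of its vertex. -/
def coproj (c : WeightedColimit F W) (d : D) (w : W.obj (.op d)) : F.obj d ⟶ c.pt :=
  ((c.equiv c.pt (𝟙 c.pt)).app (.op d)).hom w

theorem equiv_app (c : WeightedColimit F W) {X : C} (t : c.pt ⟶ X) (d : D) (w : W.obj (.op d)) :
    ((c.equiv X t).app (.op d)).hom w = c.coproj d w ≫ t := by
  have h := c.naturality (𝟙 c.pt) t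
  rw [Category.id_comp] at h
  rw [h]
  rfl

theorem le_of_coproj (c : WeightedColimit F W) {X : C} {g g' : c.pt ⟶ X}
    (h : ∀ d w, c.coproj d w ≫ g ≤ c.coproj d w ≫ g') : g ≤ g' := by
  rw [← (c.equiv X).le_iff_le]
  intro d w
  have := h d.unop w
  rw [← c.equiv_app, ← c.equiv_app] at this
  exact this

theorem coproj_desc (c : WeightedColimit F W) {X : C} (α : W ⟶ homInto F X) (d : D)
    (w : W.obj (.op d)) : c.coproj d w ≫ (c.equiv X).symm α = (α.app (.op d)).hom w := by
  rw [← c.equiv_app, OrderIso.apply_symm_apply]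

theorem coproj_map (c : WeightedColimit F W) {d e : D} (k : d ⟶ e) (w : W.obj (.op e)) :
    c.coproj d ((W.map k.op).hom w) = F.map k ≫ c.coproj e w :=
  congrArg (fun s : W.obj (.op e) ⟶ (homInto F c.pt).obj (.op d) => s.hom w)
    ((c.equiv c.pt (𝟙 c.pt)).naturality k.op)

end WeightedColimit

/-- Conical colimits, with their two-dimensional universal property: the weight is constant with
value the one-point poset. -/
theorem HasWeightedColimits.exists_cocone (hC : HasWeightedColimits C) {D : Type v}
    [SmallCategory D] (F : D ⥤ C) : ∃ c : Limits.Cocone F,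
      (∀ t : Limits.Cocone F, ∃ d : c.pt ⟶ t.pt, ∀ j, c.ι.app j ≫ d = t.ι.app j) ∧
      ∀ ⦃B : C⦄ (g g' : c.pt ⟶ B), (∀ j, c.ι.app j ≫ g ≤ c.ι.app j ≫ g') → g ≤ g' := by
  let W : Dᵒᵖ ⥤ PartOrd.{v} := (Functor.const _).obj (PartOrd.of PUnit)
  obtain ⟨c⟩ := hC.nonempty_weightedColimit F W
  refine ⟨⟨c.pt, { app := fun d => c.coproj d PUnit.unit, naturality := fun d e k => ?_ }⟩,
    fun t => ?_, fun B g g' h => c.le_of_coproj fun d w => h d⟩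
  · exact (c.coproj_map k PUnit.unit).symm.trans (Category.comp_id _).symm
  · let α : W ⟶ homInto F t.pt :=
      { app := fun d => PartOrd.ofHom ⟨fun _ => t.ι.app d.unop, fun _ _ _ => le_rfl⟩
        naturality := fun d e k => by
          ext w
          exact (t.w k.unop).symm }
    exact ⟨(c.equiv t.pt).symm α, fun j => c.coproj_desc α j PUnit.unit⟩

/-- Small coproducts, with their two-dimensional universal property. -/
theorem HasWeightedColimits.exists_coproduct (hC : HasWeightedColimits C) {J : Type v}
    (G : J → C) : ∃ (W : C) (i : ∀ j, G j ⟶ W),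
      (∀ ⦃B : C⦄ (f : ∀ j, G j ⟶ B), ∃ d : W ⟶ B, ∀ j, i j ≫ d = f j) ∧
      ∀ ⦃B : C⦄ (g g' : W ⟶ B), (∀ j, i j ≫ g ≤ i j ≫ g') → g ≤ g' := by
  obtain ⟨c, hd, ho⟩ := hC.exists_cocone (Discrete.functor G)
  refine ⟨c.pt, fun j => c.ι.app ⟨j⟩, fun B f => ?_, fun B g g' h => ho g g' fun j => h j.as⟩
  obtain ⟨d, h⟩ := hd (Limits.Cofan.mk B f)
  exact ⟨d, fun j => h ⟨j⟩⟩

/-- Small wide pushouts, with their two-dimensional universal property. -/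
theorem HasWeightedColimits.exists_widePushout (hC : HasWeightedColimits C) {J : Type v} {W : C}
    {Q : J → C} (q : ∀ j, W ⟶ Q j) : ∃ (P : C) (c : W ⟶ P) (i : ∀ j, Q j ⟶ P),
      (∀ j, q j ≫ i j = c) ∧
      (∀ ⦃B : C⦄ (f : W ⟶ B) (f' : ∀ j, Q j ⟶ B), (∀ j, q j ≫ f' j = f) →
        ∃ d : P ⟶ B, c ≫ d = f ∧ ∀ j, i j ≫ d = f' j) ∧
      ∀ ⦃B : C⦄ (g g' : P ⟶ B), c ≫ g ≤ c ≫ g' → (∀ j, i j ≫ g ≤ i j ≫ g') → g ≤ g' := by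
  open Limits in
  obtain ⟨c, hd, ho⟩ := hC.exists_cocone (WidePushoutShape.wideSpan W Q q)
  refine ⟨c.pt, c.ι.app none, fun j => c.ι.app (some j),
    fun j => c.w (WidePushoutShape.Hom.init j), fun B f f' h => ?_, fun B g g' h h' => ?_⟩
  · obtain ⟨d, hd⟩ := hd (WidePushoutShape.mkCocone f f' h)
    exact ⟨d, hd none, fun j => hd (some j)⟩
  · refine ho g g' ?_
    rintro (_ | j)
    exacts [h, h' j]

/-- Coinserters: the universal morphism `q` with `a ≫ q ≤ b ≫ q`. -/
theorem HasWeightedColimits.exists_coinserter (hC : HasWeightedColimits C) {Z W : C}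
    (a b : Z ⟶ W) : ∃ (Q : C) (q : W ⟶ Q), a ≫ q ≤ b ≫ q ∧
      (∀ ⦃B : C⦄ (f : W ⟶ B), a ≫ f ≤ b ≫ f → ∃ d : Q ⟶ B, q ≫ d = f) ∧
      ∀ ⦃B : C⦄ (g g' : Q ⟶ B), q ≫ g ≤ q ≫ g' → g ≤ g' := by
  open Limits in
  let F : AsSmall.{v} WalkingParallelPair ⥤ C := AsSmall.down ⋙ parallelPair a b
  -- The weight takes the value `{0}` at `W` and the two-element chain `{0 < 1}` at `Z`.
  let s : Bool → (PartOrd.of PUnit.{v + 1} ⟶ PartOrd.of (ULift.{v} Bool)) := fun x =>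
    PartOrd.ofHom ⟨fun _ => ⟨x⟩, fun _ _ _ => le_rfl⟩
  let V : (AsSmall.{v} WalkingParallelPair)ᵒᵖ ⥤ PartOrd.{v} :=
    AsSmall.down.op ⋙ walkingParallelPairOp.leftOp ⋙ parallelPair (s false) (s true)
  obtain ⟨c⟩ := hC.nonempty_weightedColimit F V
  let Z' : AsSmall.{v} WalkingParallelPair := ⟨.zero⟩
  let W' : AsSmall.{v} WalkingParallelPair := ⟨.one⟩
  let l : Z' ⟶ W' := ⟨WalkingParallelPairHom.left⟩
  let r : Z' ⟶ W' := ⟨WalkingParallelPairHom.right⟩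
  have hl : c.coproj Z' ⟨false⟩ = a ≫ c.coproj W' PUnit.unit := c.coproj_map l PUnit.unit
  have hr : c.coproj Z' ⟨true⟩ = b ≫ c.coproj W' PUnit.unit := c.coproj_map r PUnit.unit
  refine ⟨c.pt, c.coproj W' PUnit.unit, ?_, fun B f h => ?_, fun B g g' h => ?_⟩
  · rw [← hl, ← hr]
    exact ((c.equiv c.pt (𝟙 c.pt)).app (.op Z')).hom.monotone
      (show (⟨false⟩ : ULift.{v} Bool) ≤ ⟨true⟩ from Bool.false_le _)
  · let α : V ⟶ homInto F B :=
      { app := fun d => match d with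
          | ⟨⟨.zero⟩⟩ => PartOrd.ofHom ⟨fun x : ULift Bool => match x with
              | ⟨false⟩ => (a ≫ f : Z ⟶ B)
              | ⟨true⟩ => (b ≫ f : Z ⟶ B), by
                rintro ⟨_ | _⟩ ⟨_ | _⟩ hxy
                exacts [le_rfl, h, absurd hxy (by decide), le_rfl]⟩
          | ⟨⟨.one⟩⟩ => PartOrd.ofHom ⟨fun _ => f, fun _ _ _ => le_rfl⟩
        naturality := by
          rintro ⟨⟨d⟩⟩ ⟨⟨e⟩⟩ k
          obtain ⟨⟨k : WalkingParallelPairHom e d⟩⟩ := k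
          cases k with
          | left => rfl
          | right => rfl
          | id =>
            cases d
            · ext ⟨_ | _⟩
              exacts [(Category.id_comp (a ≫ f)).symm, (Category.id_comp (b ≫ f)).symm]
            · ext
              exact (Category.id_comp f).symm }
    exact ⟨(c.equiv B).symm α, c.coproj_desc α W' PUnit.unit⟩
  · have hlc (t : c.pt ⟶ B) : c.coproj Z' ⟨false⟩ ≫ t = a ≫ c.coproj W' PUnit.unit ≫ t :=
      (congrArg (· ≫ t) hl).trans (Category.assoc _ _ _)
    have hrc (t : c.pt ⟶ B) : c.coproj Z' ⟨true⟩ ≫ t = b ≫ c.coproj W' PUnit.unit ≫ t :=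
      (congrArg (· ≫ t) hr).trans (Category.assoc _ _ _)
    refine c.le_of_coproj ?_
    rintro ⟨_ | _⟩ w
    · obtain ⟨_ | _⟩ := w
      · exact (hlc g).le.trans ((comp_le_comp_left a h).trans (hlc g').ge)
      · exact (hrc g).le.trans ((comp_le_comp_left b h).trans (hrc g').ge)
    · exact h

end

/-! ### Separated objects generated by a family of morphisms -/

section

variable {C : Type u} [Category.{v} C] [OrderEnriched C]

theorem IsOrderMono.eq_of_comp_eq {I X J : C} {i : I ⟶ X} (hi : IsOrderMono i) {f g : J ⟶ I}
    (h : f ≫ i = g ≫ i) : f = g :=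
  le_antisymm (hi f g h.le) (hi g f h.ge)

theorem IsOrderMono.isIso_of_section {I X : C} {i : I ⟶ X} (hi : IsOrderMono i) (s : X ⟶ I)
    (hs : s ≫ i = 𝟙 X) : IsIso i :=
  ⟨s, hi.eq_of_comp_eq (by simp [hs]), hs⟩

/-- A morphism lies in `E` as soon as the `M`-part of each of its factorizations splits. -/
theorem IsProperFactorizationSystem.mem_left_of_section {E M : MorphismProperty C}
    (hEM : IsProperFactorizationSystem E M) {X Y : C} (c : X ⟶ Y)
    (h : ∀ ⦃I : C⦄ (e : X ⟶ I) (m : I ⟶ Y), E e → M m → e ≫ m = c → ∃ s, s ≫ m = 𝟙 Y) :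
    E c := by
  obtain ⟨I, e, m, he, hm, rfl⟩ := hEM.factors c
  obtain ⟨s, hs⟩ := h e m he hm rfl
  have := (hEM.orderMono m hm).isIso_of_section s hs
  have := hEM.respectsIso_left
  exact MorphismProperty.RespectsIso.postcomp E m e he

/-- Every class of morphisms `χ i : W ⟶ B i` factors through a largest quotient `c` of `W` in `E`,
and the induced morphisms are jointly order-monic. The quotient `c` is the cointersection of the
order-epic quotients in `E` through which all `χ i` factor; there is only a set of them. If
`a ≫ ψ i ≤ b ≫ ψ i` for all `i`, then `c` followed by the coinserter of `a` and `b` is again one of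
these quotients, so `a ≤ b` holds already. -/
theorem IsLocallyRanked.exists_separated_quotient {E M : MorphismProperty C}
    (hC : IsLocallyRanked E M) {W : C} {ι : Type u'} (B : ι → C) (χ : ∀ i, W ⟶ B i) :
    ∃ (Y : C) (c : W ⟶ Y) (ψ : ∀ i, Y ⟶ B i), E c ∧ (∀ i, c ≫ ψ i = χ i) ∧
      (∀ ⦃X : C⦄ (g g' : Y ⟶ X), c ≫ g ≤ c ≫ g' → g ≤ g') ∧
      ∀ ⦃Z : C⦄ (a b : Z ⟶ Y), (∀ i, a ≫ ψ i ≤ b ≫ ψ i) → a ≤ b := by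
  obtain ⟨κ, Q, q, hqE, hQ⟩ := hC.cowellpowered W
  let S := {k : κ // (∀ i, ∃ t, q k ≫ t = χ i) ∧
    ∀ ⦃X : C⦄ (g g' : Q k ⟶ X), q k ≫ g ≤ q k ≫ g' → g ≤ g'}
  choose t ht using fun s : S => s.2.1
  obtain ⟨Y, c, j, hj, hd, ho⟩ := hC.weightedColimits.exists_widePushout fun s : S => q s
  have hcd {X : C} (g g' : Y ⟶ X) (h : c ≫ g ≤ c ≫ g') : g ≤ g' :=
    ho g g' h fun s => s.2.2 _ _ (by simpa only [← Category.assoc, hj] using h)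
  have hce {X : C} {g g' : Y ⟶ X} (h : c ≫ g = c ≫ g') : g = g' :=
    le_antisymm (hcd _ _ h.le) (hcd _ _ h.ge)
  have hcE : E c := by
    refine hC.proper.mem_left_of_section c fun I e m he hm hem => ?_
    choose d hde _ using fun s : S =>
      (hC.proper.diagonal e (j s) (hqE s) hm (hem.trans (hj s).symm)).exists
    obtain ⟨r, hr, -⟩ := hd e d hde
    exact ⟨r, hce (by rw [← Category.assoc, hr, hem, Category.comp_id])⟩
  choose ψ hψ hψ' using fun i => hd (χ i) (fun s => t s i) fun s => ht s i
  refine ⟨Y, c, ψ, hcE, hψ, @hcd, fun Z a b hab => ?_⟩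
  obtain ⟨Y', k, hk, hkd, hko⟩ := hC.weightedColimits.exists_coinserter a b
  choose ψ' hψ' using fun i => hkd (ψ i) (hab i)
  have hck {X : C} (g g' : Y' ⟶ X) (h : (c ≫ k) ≫ g ≤ (c ≫ k) ≫ g') : g ≤ g' :=
    hko _ _ (hcd _ _ (by simpa only [Category.assoc] using h))
  have hckE : E (c ≫ k) := by
    refine hC.proper.mem_left_of_section _ fun I e m he hm hem => ?_
    obtain ⟨d, hde, hdm⟩ := (hC.proper.diagonal e k hcE hm hem).exists
    obtain ⟨r, hr⟩ := hkd d (hC.proper.orderMono m hm _ _ (by simpa only [Category.assoc, hdm]))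
    have h : k ≫ r ≫ m = k ≫ 𝟙 Y' := by rw [← Category.assoc, hr, hdm, Category.comp_id]
    exact ⟨r, le_antisymm (hko _ _ h.le) (hko _ _ h.ge)⟩
  obtain ⟨n, φ, hφ⟩ := hQ Y' (c ≫ k) hckE
  have hqn : q n = c ≫ k ≫ φ.inv := by rw [← Category.assoc, ← hφ]; simp
  let s : S := by
    refine ⟨n, fun i => ⟨φ.hom ≫ ψ' i, ?_⟩, fun X g g' h => ?_⟩
    · rw [← Category.assoc, hφ, Category.assoc, hψ', hψ]
    · have h' := hck (φ.inv ≫ g) (φ.inv ≫ g') (by simpa only [hqn, Category.assoc] using h)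
      simpa using comp_le_comp_left φ.hom h'
  -- The coinserter `k` of the pair is split: the pushout already absorbs it.
  have hks : k ≫ φ.inv ≫ j s = 𝟙 Y := by
    refine hce ?_
    have h : q n ≫ j s = c := hj s
    rw [hqn] at h
    simpa only [Category.assoc, Category.comp_id] using h
  have h := comp_le_comp_right hk (φ.inv ≫ j s)
  simpa only [Category.assoc, hks, Category.comp_id] using h

/-- A small family `G j` with a class of families `φ i j : G j ⟶ B i` generates an object `Y`
on which the induced morphisms `ψ i : Y ⟶ B i` are jointly order-monic, while the coprojections
`y j : G j ⟶ Y` are jointly order-epic and factor jointly through no proper `M`-subobject. -/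
theorem IsLocallyRanked.exists_generated {E M : MorphismProperty C} (hC : IsLocallyRanked E M)
    {J : Type v} (G : J → C) {ι : Type u'} (B : ι → C) (φ : ∀ i j, G j ⟶ B i) :
    ∃ (Y : C) (y : ∀ j, G j ⟶ Y) (ψ : ∀ i, Y ⟶ B i), (∀ i j, y j ≫ ψ i = φ i j) ∧
      (∀ ⦃Z : C⦄ (a b : Z ⟶ Y), (∀ i, a ≫ ψ i ≤ b ≫ ψ i) → a ≤ b) ∧
      (∀ ⦃X : C⦄ (g g' : Y ⟶ X), (∀ j, y j ≫ g ≤ y j ≫ g') → g ≤ g') ∧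
      IsUnion M G y := by
  obtain ⟨W, w, hW, hW'⟩ := hC.weightedColimits.exists_coproduct G
  choose χ hχ using fun i => hW (φ i)
  obtain ⟨Y, c, ψ, hcE, hψ, hco, hsep⟩ := hC.exists_separated_quotient B χ
  refine ⟨Y, fun j => w j ≫ c, ψ, fun i j => ?_, hsep, fun X g g' h => ?_, fun N n hn hk => ?_⟩
  · rw [Category.assoc, hψ, hχ]
  · exact hco _ _ (hW' _ _ fun j => by simpa only [Category.assoc] using h j)
  · choose k hk using hk
    obtain ⟨k', hk'⟩ := hW k
    have hkn : k' ≫ n = c := by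
      have h (j) : w j ≫ k' ≫ n = w j ≫ c := by rw [← Category.assoc, hk', hk]
      exact le_antisymm (hW' _ _ fun j => (h j).le) (hW' _ _ fun j => (h j).ge)
    obtain ⟨d, -, hd⟩ := (hC.proper.diagonal k' (𝟙 Y) hcE hn (by simpa using hkn)).exists
    exact (hC.proper.orderMono n hn).isIso_of_section d hd

end

/-! ### Extensions of an object along which a subcategory is Kan-injective -/

section

variable {C : Type u} [Category.{v} C] [OrderEnriched C]

theorem IsLan.eq {A A' X : C} {h : A ⟶ A'} {f : A ⟶ X} {l l' : A' ⟶ X} (hl : IsLan h f l)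
    (hl' : IsLan h f l') : l = l' :=
  le_antisymm (hl.2 _ hl'.1) (hl'.2 _ hl.1)

/-- A morphism from `X` into an object of the subcategory `K`. -/
structure Test (K : Subcategory C) (X : C) where
  cod : C
  mem : K.obj cod
  hom : X ⟶ cod

/-- Postcomposition with a morphism of `K`. -/
@[simps]
def Test.postcomp {K : Subcategory C} {X : C} (t : Test K X) {B : C} (p : t.cod ⟶ B)
    (hp : K.hom p) : Test K X where
  cod := B
  mem := K.target p hp
  hom := t.hom ≫ p

/-- A morphism `unit : X ⟶ pt` with respect to which all objects and morphisms of `K` are left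
Kan-injective, and such that the left Kan extensions `ext t` along `unit` of all morphisms from
`X` into `K` are jointly order-monic. -/
structure Extension (K : Subcategory C) (X : C) where
  pt : C
  unit : X ⟶ pt
  ext (t : Test K X) : pt ⟶ t.cod
  fac (t : Test K X) : unit ≫ ext t = t.hom
  ext_le (t : Test K X) (g : pt ⟶ t.cod) : t.hom ≤ unit ≫ g → ext t ≤ g
  ext_postcomp (t : Test K X) {B : C} (p : t.cod ⟶ B) (hp : K.hom p) :
    ext (t.postcomp p hp) = ext t ≫ p
  separated {Z : C} (a b : Z ⟶ pt) : (∀ t, a ≫ ext t ≤ b ≫ ext t) → a ≤ b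

namespace Extension

variable {K : Subcategory C} {X : C}

theorem isLan (Y : Extension K X) (t : Test K X) : IsLan Y.unit t.hom (Y.ext t) :=
  ⟨(Y.fac t).ge, Y.ext_le t⟩

/-- A morphism between the underlying objects that commutes with all `ext t`. By separatedness
there is at most one. -/
def Compatible (Y Z : Extension K X) (k : Y.pt ⟶ Z.pt) : Prop :=
  ∀ t, k ≫ Z.ext t = Y.ext t

theorem hom_ext (Y : Extension K X) {Z : C} {a b : Z ⟶ Y.pt}
    (h : ∀ t, a ≫ Y.ext t = b ≫ Y.ext t) : a = b :=
  le_antisymm (Y.separated a b fun t => (h t).le) (Y.separated b a fun t => (h t).ge)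

theorem Compatible.comp {Y Z T : Extension K X} {k : Y.pt ⟶ Z.pt} {l : Z.pt ⟶ T.pt}
    (hk : Compatible Y Z k) (hl : Compatible Z T l) : Compatible Y T (k ≫ l) := fun t => by
  rw [Category.assoc, hl, hk]

theorem Compatible.unique {Y Z : Extension K X} {k l : Y.pt ⟶ Z.pt} (hk : Compatible Y Z k)
    (hl : Compatible Y Z l) : k = l :=
  Z.hom_ext fun t => (hk t).trans (hl t).symm

/-- Extensions are preordered by the existence of compatible morphisms. -/
instance : Preorder (Extension K X) where
  le Y Z := ∃ k, Compatible Y Z k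
  le_refl Y := ⟨𝟙 _, fun t => Category.id_comp _⟩
  le_trans _ _ _ := fun ⟨_, hk⟩ ⟨_, hl⟩ => ⟨_, hk.comp hl⟩

variable {E M : MorphismProperty C}

/-- The extension generated by a family `G j`, one member of which receives a morphism from `X`.
The last hypothesis says that any `g` extending a test morphism dominates the given morphisms on
all members of the family. -/
theorem exists_generated (hC : IsLocallyRanked E M) {J : Type v} (G : J → C)
    (φ : ∀ (t : Test K X) (j : J), G j ⟶ t.cod)
    (hφ : ∀ (t : Test K X) {B : C} (p : t.cod ⟶ B) (hp : K.hom p) (j : J),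
      φ (t.postcomp p hp) j = φ t j ≫ p)
    (j₀ : J) (x : X ⟶ G j₀) (hx : ∀ t, x ≫ φ t j₀ = t.hom)
    (hle : ∀ (Y : C) (y : ∀ j, G j ⟶ Y) (ψ : ∀ t : Test K X, Y ⟶ t.cod),
      (∀ t j, y j ≫ ψ t = φ t j) →
      (∀ ⦃Z : C⦄ (a b : Z ⟶ Y), (∀ t, a ≫ ψ t ≤ b ≫ ψ t) → a ≤ b) →
      ∀ (t : Test K X) (g : Y ⟶ t.cod), t.hom ≤ x ≫ y j₀ ≫ g → ∀ j, φ t j ≤ y j ≫ g) :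
    ∃ (Z : Extension K X) (y : ∀ j, G j ⟶ Z.pt),
      (∀ t j, y j ≫ Z.ext t = φ t j) ∧ IsUnion M G y := by
  obtain ⟨Y, y, ψ, hψ, hsep, ho, hU⟩ := hC.exists_generated G Test.cod φ
  refine ⟨⟨Y, x ≫ y j₀, ψ, fun t => ?_, fun t g hg => ?_, fun t B p hp => ?_, @hsep⟩, y, hψ, hU⟩
  · rw [Category.assoc, hψ, hx]
  · exact ho _ _ fun j => (hψ t j).le.trans
      (hle Y y ψ hψ hsep t g (by simpa only [Category.assoc] using hg) j)
  · have h (j) : y j ≫ ψ (t.postcomp p hp) = y j ≫ ψ t ≫ p := by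
      rw [← Category.assoc, hψ, hψ, hφ]
    exact le_antisymm (ho _ _ fun j => (h j).le) (ho _ _ fun j => (h j).ge)

theorem nonempty (hC : IsLocallyRanked E M) (K : Subcategory C) (X : C) :
    Nonempty (Extension K X) := by
  obtain ⟨Z, -⟩ := exists_generated (K := K) (X := X) hC (fun _ : PUnit.{v + 1} => X)
    (fun t _ => t.hom) (fun t B p hp _ => rfl) PUnit.unit (𝟙 X) (fun t => Category.id_comp _)
    (fun Y y ψ _ _ t g hg _ => by simpa using hg)
  exact ⟨Z⟩

/-- Every small nonempty family of extensions has an upper bound that is its union. -/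
theorem exists_union (hC : IsLocallyRanked E M) {J : Type v} [Nonempty J]
    (Y : J → Extension K X) : ∃ (Z : Extension K X) (y : ∀ j, (Y j).pt ⟶ Z.pt),
      (∀ j, Compatible (Y j) Z (y j)) ∧ IsUnion M (fun j => (Y j).pt) y := by
  obtain ⟨j₀⟩ := ‹Nonempty J›
  obtain ⟨Z, y, hy, hU⟩ := exists_generated (K := K) (X := X) hC (fun j => (Y j).pt)
    (fun t j => (Y j).ext t) (fun t B p hp j => (Y j).ext_postcomp t p hp) j₀ (Y j₀).unit
    (Y j₀).fac (by
      intro T y ψ hψ hsep t g hg j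
      -- All composites `(Y j).unit ≫ y j` agree, by separatedness.
      have h : (Y j).unit ≫ y j = (Y j₀).unit ≫ y j₀ := le_antisymm
        (hsep _ _ fun t => by simp only [Category.assoc, hψ, fac, le_refl])
        (hsep _ _ fun t => by simp only [Category.assoc, hψ, fac, le_refl])
      exact (Y j).ext_le t _ (by rwa [← Category.assoc, h, Category.assoc]))
  exact ⟨Z, y, fun j t => hy t j, hU⟩

theorem exists_ge (hC : IsLocallyRanked E M) {J : Type v} [Nonempty J] (Y : J → Extension K X) :
    ∃ Z, ∀ j, Y j ≤ Z := by
  obtain ⟨Z, y, hy, -⟩ := exists_union hC Y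
  exact ⟨Z, fun j => ⟨y j, hy j⟩⟩

/-- For every extension `Y` there is a larger one `Z` that already contains the image of `Y` in
every extension `T` above `Z`. Indeed `Y` has only a set of quotients, so `Z` can be chosen above
witnesses for all quotients of `Y` through which some compatible morphism factors. -/
theorem exists_stable (hC : IsLocallyRanked E M) (Y : Extension K X) :
    ∃ Z, Y ≤ Z ∧ ∀ (T : Extension K X) (k : Y.pt ⟶ T.pt) (l : Z.pt ⟶ T.pt),
      Compatible Y T k → Compatible Z T l → ∀ (I : C) (e : Y.pt ⟶ I) (m : I ⟶ T.pt), E e →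
        e ≫ m = k → ∃ d : I ⟶ Z.pt, d ≫ l = m := by
  obtain ⟨κ, Q, q, hqE, hQ⟩ := hC.cowellpowered Y.pt
  let S := {i : κ // ∃ (T : Extension K X) (n : Q i ⟶ T.pt), Compatible Y T (q i ≫ n)}
  choose T n hn using fun s : S => s.2
  obtain ⟨Z, hZ⟩ := exists_ge hC fun s : Option S => s.elim Y T
  refine ⟨Z, hZ none, fun T' k l hk hl I e m he hem => ?_⟩
  obtain ⟨i, φ, rfl⟩ := hQ I e he
  let s : S := ⟨i, T', φ.hom ≫ m, by rwa [← Category.assoc, hem]⟩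
  obtain ⟨z : (T s).pt ⟶ Z.pt, hz⟩ := hZ (some s)
  refine ⟨φ.inv ≫ n s ≫ z, ?_⟩
  have := hC.proper.epi _ he
  have h : (q i ≫ φ.hom) ≫ φ.inv ≫ n s ≫ z ≫ l = k := by
    refine Compatible.unique (Y := Y) (Z := T') (fun t => ?_) hk
    have hzl := (Compatible.comp (Y := T s) hz hl) t
    have hns := hn s t
    simp only [Category.assoc] at hzl hns
    simpa only [Category.assoc, Iso.hom_inv_id_assoc, hzl] using hns
  rw [← cancel_epi (q i ≫ φ.hom), hem, ← h]
  simp only [Category.assoc]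

/-- One step of the free completion of `Y` under left Kan extensions along the members of a set
of morphisms: for all `f : A s ⟶ Y.pt` a copy of `A' s` is adjoined, which is mapped to the test
objects by the left Kan extensions of the morphisms `f ≫ Y.ext t`. -/
theorem exists_closure (hC : IsLocallyRanked E M) {S : Type v} {A A' : S → C}
    (h : ∀ s, A s ⟶ A' s) (Y : Extension (wLInj (.ofHoms h)) X) :
    ∃ Z, Y ≤ Z ∧ ∀ (s : S) (f : A s ⟶ Y.pt), ∃ l : A' s ⟶ Z.pt,
      ∀ t, IsLan (h s) (f ≫ Y.ext t) (l ≫ Z.ext t) := by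
  choose lan hlan using fun (t : Test (wLInj (.ofHoms h)) X) (s : S) (f : A s ⟶ Y.pt) =>
    t.mem (h s) ⟨s⟩ (f ≫ Y.ext t)
  let G : Option (Σ s, A s ⟶ Y.pt) → C := fun j => j.elim Y.pt fun a => A' a.1
  let φ (t : Test (wLInj (.ofHoms h)) X) : ∀ j, G j ⟶ t.cod
    | none => Y.ext t
    | some a => lan t a.1 a.2
  have hφ (t : Test (wLInj (.ofHoms h)) X) {B : C} (p : t.cod ⟶ B)
      (hp : (wLInj (.ofHoms h)).hom p) : ∀ j, φ (t.postcomp p hp) j = φ t j ≫ p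
    | none => Y.ext_postcomp t p hp
    | some ⟨s, f⟩ => by
      refine (hlan (t.postcomp p hp) s f).eq ?_
      have := (hp (h s) ⟨s⟩).2.2 _ _ (hlan t s f)
      rwa [Category.assoc, ← Y.ext_postcomp t p hp] at this
  obtain ⟨Z, y, hy, -⟩ := exists_generated hC G φ hφ none Y.unit Y.fac (by
    intro T y ψ hψ hsep t g hg j
    let yn : Y.pt ⟶ T := y none
    have hyn (t) : yn ≫ ψ t = Y.ext t := hψ t none
    have hY : Y.ext t ≤ yn ≫ g := Y.ext_le t _ hg
    rcases j with _ | ⟨s, f⟩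
    · exact hY
    · let yf : A' s ⟶ T := y (some ⟨s, f⟩)
      have hyf (t) : yf ≫ ψ t = lan t s f := hψ t (some ⟨s, f⟩)
      have hf : f ≫ yn ≤ h s ≫ yf := hsep _ _ fun t => by
        simpa only [Category.assoc, hyf, hyn] using (hlan t s f).1
      refine (hlan t s f).2 (yf ≫ g) ((comp_le_comp_left f hY).trans ?_)
      simpa only [Category.assoc] using comp_le_comp_right hf g)
  refine ⟨Z, ⟨y none, fun t => hy t none⟩, fun s f => ⟨y (some ⟨s, f⟩), fun t => ?_⟩⟩
  have hyf : (y (some ⟨s, f⟩) : A' s ⟶ Z.pt) ≫ Z.ext t = lan t s f := hy t (some ⟨s, f⟩)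
  exact hyf.symm ▸ hlan t s f

end Extension

end

/-! ### Convergence -/

/-- In a preorder with small upper bounds, an inflationary iteration of any map `Φ` along a
well-order, above a given element. -/
theorem exists_chain {P : Type u'} [Preorder P]
    (hub : ∀ {J : Type v} [Nonempty J] (Y : J → P), ∃ Z, ∀ j, Y j ≤ Z) (Z₀ : P) (Φ : P → P)
    (I : Type v) [LinearOrder I] [WellFoundedLT I] :
    ∃ Y : I → P, (∀ i, Z₀ ≤ Y i) ∧ ∀ i j, i < j → Φ (Y i) ≤ Y j := by
  choose sup hsup using fun (i : I) (Y : Option (Set.Iio i) → P) => hub Y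
  let Y : I → P := WellFounded.fix wellFounded_lt fun i rec =>
    sup i fun o => o.elim Z₀ fun j => Φ (rec j.1 j.2)
  have hY (i) : Y i = sup i fun o => o.elim Z₀ fun j => Φ (Y j.1) :=
    WellFounded.fix_eq _ _ _
  refine ⟨Y, fun i => ?_, fun i j hij => ?_⟩
  · rw [hY]
    exact hsup i (fun o => o.elim Z₀ fun j => Φ (Y j.1)) none
  · rw [hY j]
    exact hsup j (fun o => o.elim Z₀ fun j => Φ (Y j.1)) (some ⟨i, hij⟩)

section

variable {C : Type u} [Category.{v} C] [OrderEnriched C]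

/-- Some extension is closed under left Kan extensions along the members of a set of morphisms. -/
theorem Extension.exists_closed {E M : MorphismProperty C} (hC : IsLocallyRanked E M) {S : Type v}
    {A A' : S → C} (h : ∀ s, A s ⟶ A' s) (X : C) :
    ∃ Z : Extension (wLInj (.ofHoms h)) X, ∀ (s : S) (f : A s ⟶ Z.pt), ∃ l : A' s ⟶ Z.pt,
      ∀ t, IsLan (h s) (f ≫ Z.ext t) (l ≫ Z.ext t) := by
  classical
  -- The domains `A s` may have different ranks. A rank of the coproduct `T` of those `A s` that
  -- map to some extension works for all of them.
  let S' := {s : S // ∃ Z : Extension (wLInj (.ofHoms h)) X, Nonempty (A s ⟶ Z.pt)}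
  choose W a using fun s : S' => s.2
  obtain ⟨W₀⟩ := Extension.nonempty hC (wLInj (.ofHoms h)) X
  obtain ⟨Z₀, hZ₀⟩ := Extension.exists_ge hC fun s : Option S' => s.elim W₀ W
  obtain ⟨T, i, hT, -⟩ := hC.weightedColimits.exists_coproduct fun s : S' => A s
  obtain ⟨lam, hreg, hrank⟩ := hC.rank T
  have hlim := Cardinal.noMaxOrder hreg.aleph0_le
  have hne : Nonempty lam.ord.ToType := by
    rw [← Cardinal.mk_ne_zero_iff, Cardinal.mk_ord_toType]
    exact hreg.ne_zero
  choose Y' hYY' hY' using Extension.exists_stable hC (K := wLInj (.ofHoms h)) (X := X)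
  choose Φ hΦ hΦ' using Extension.exists_closure hC h (X := X)
  obtain ⟨Y, hY₀, hY⟩ := exists_chain (Extension.exists_ge hC) Z₀ (fun Y => Φ (Y' Y))
    lam.ord.ToType
  obtain ⟨Z, y, hy, hU⟩ := Extension.exists_union hC Y
  choose I e m he hm hem using fun i => hC.proper.factors (y i)
  -- The images of the members of the chain form a chain of subobjects with union `Z`.
  have hchain : IsSubobjectChain M lam I m := by
    refine ⟨hm, fun j k hjk => ?_⟩
    obtain rfl | hlt := hjk.eq_or_lt
    · exact ⟨𝟙 _, Category.id_comp _⟩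
    · obtain ⟨r, hr⟩ : Y j ≤ Y k := (hYY' _).trans ((hΦ _).trans (hY j k hlt))
      have hrj : r ≫ y k = y j := (hr.comp (hy k)).unique (hy j)
      obtain ⟨d, -, hd⟩ := (hC.proper.diagonal (r ≫ e k) (m j) (he j) (hm k) (by
        rw [Category.assoc, hem, hem, hrj])).exists
      exact ⟨d, hd⟩
  have hunion : IsUnion M I m := fun N n hn hk => hU n hn fun j => by
    obtain ⟨k, hk⟩ := hk j
    exact ⟨e j ≫ k, by rw [Category.assoc, hk, hem]⟩
  refine ⟨Z, fun s f => ?_⟩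
  obtain ⟨j₀⟩ := hne
  have hW (s : S') : W s ≤ Z := (hZ₀ (some s)).trans ((hY₀ j₀).trans ⟨y j₀, hy j₀⟩)
  let s' : S' := ⟨s, Z, ⟨f⟩⟩
  -- Extend `f` to the coproduct by the chosen morphisms.
  obtain ⟨g, hg⟩ : ∃ g : ∀ s : S', A s ⟶ Z.pt, g s' = f :=
    ⟨Function.update (fun s => (a s).some ≫ (hW s).choose) s' f,
      Function.update_self (β := fun s : S' => A s ⟶ Z.pt) s' f _⟩
  obtain ⟨p, hp⟩ := hT g
  obtain ⟨j, p', hp'⟩ := hrank I m hchain hunion p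
  have hf : f = i s' ≫ p' ≫ m j := by
    rw [hp', hp, hg]
  obtain ⟨k, hjk⟩ := exists_gt j
  obtain ⟨c, hc⟩ : Φ (Y' (Y j)) ≤ Z := (hY j k hjk).trans ⟨y k, hy k⟩
  obtain ⟨b, hb⟩ := hΦ (Y' (Y j))
  obtain ⟨d, hd⟩ := hY' (Y j) Z (y j) (b ≫ c) (hy j) (hb.comp hc) (I j) (e j) (m j) (he j) (hem j)
  obtain ⟨l, hl⟩ := hΦ' (Y' (Y j)) s (i s' ≫ p' ≫ d)
  refine ⟨l ≫ c, fun t => ?_⟩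
  have h₁ : f ≫ Z.ext t = (i s' ≫ p' ≫ d) ≫ (Y' (Y j)).ext t := by
    rw [hf, ← hd, ← (hb.comp hc) t]
    simp only [Category.assoc]
  rw [h₁, Category.assoc l c, hc t]
  exact hl t

/-! ### Weak Kan-injectivity as Kan-injectivity -/

/-- The morphisms with respect to which all objects and morphisms of `K` are left
Kan-injective. -/
def kanClosure (K : Subcategory C) : MorphismProperty C := fun _ _ h =>
  (∀ B, K.obj B → LeftKanInjObj h B) ∧ ∀ ⦃B B'⦄ (p : B ⟶ B'), K.hom p → LeftKanInjHom h p

theorem Extension.kanClosure_unit {K : Subcategory C} {X : C} (Z : Extension K X) :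
    kanClosure K Z.unit := by
  have hobj (B) (hB : K.obj B) : LeftKanInjObj Z.unit B := fun f =>
    ⟨Z.ext ⟨B, hB, f⟩, Z.isLan ⟨B, hB, f⟩, Z.fac ⟨B, hB, f⟩⟩
  refine ⟨hobj, fun B B' p hp => ⟨hobj B (K.source p hp), hobj B' (K.target p hp),
    fun f l hl => ?_⟩⟩
  let t : Test K X := ⟨B, K.source p hp, f⟩
  rw [hl.eq (Z.isLan t), ← Z.ext_postcomp t p hp]
  exact Z.isLan (t.postcomp p hp)

/-- Every object `X` has an extension that lies in `wLInj H`, together with all its left Kan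
extensions of morphisms from `X`. -/
theorem exists_extension_mem {E M : MorphismProperty C} (hC : IsLocallyRanked E M)
    (H : MorphismProperty C) [MorphismProperty.IsSmall.{v} H] (X : C) :
    ∃ Z : Extension (wLInj H) X, (wLInj H).obj Z.pt ∧ ∀ t, (wLInj H).hom (Z.ext t) := by
  obtain ⟨S, A, A', h, rfl⟩ := (MorphismProperty.isSmall_iff_eq_ofHoms.{v} H).1 inferInstance
  obtain ⟨Z, hZ⟩ := Extension.exists_closed hC h X
  have hlan (s) (f : A s ⟶ Z.pt) :
      ∃ l, IsLan (h s) f l ∧ ∀ t, IsLan (h s) (f ≫ Z.ext t) (l ≫ Z.ext t) := by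
    obtain ⟨l, hl⟩ := hZ s f
    refine ⟨l, ⟨Z.separated _ _ fun t => ?_, fun g hg => Z.separated _ _ fun t => ?_⟩, hl⟩
    · simpa only [Category.assoc] using (hl t).1
    · exact (hl t).2 _ (by simpa only [Category.assoc] using comp_le_comp_right hg (Z.ext t))
  have hobj : (wLInj (.ofHoms h)).obj Z.pt := by
    rintro _ _ _ ⟨s⟩ f
    obtain ⟨l, hl, -⟩ := hlan s f
    exact ⟨l, hl⟩
  refine ⟨Z, hobj, fun t => ?_⟩
  rintro _ _ _ ⟨s⟩
  refine ⟨hobj _ ⟨s⟩, t.mem _ ⟨s⟩, fun f l hl => ?_⟩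
  obtain ⟨l', hl', hext⟩ := hlan s f
  rw [hl.eq hl']
  exact hext t

/-- Left Kan extensions into a retract `X` of `R` are computed in `R`. -/
theorem IsLan.of_retract {A A' X R : C} {h : A ⟶ A'} {f : A ⟶ X} {r : X ⟶ R} {ρ : R ⟶ X}
    (hr : r ≫ ρ = 𝟙 X) {l : A' ⟶ R} (hl : IsLan h (f ≫ r) l) : IsLan h f (l ≫ ρ) := by
  refine ⟨?_, fun g hg => ?_⟩
  · simpa only [Category.assoc, hr, Category.comp_id] using comp_le_comp_right hl.1 ρ
  · have := comp_le_comp_right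
      (hl.2 (g ≫ r) (by simpa only [Category.assoc] using comp_le_comp_right hg r)) ρ
    simpa only [Category.assoc, hr, Category.comp_id] using this

end

end KanInjectivity

open KanInjectivity in
theorem mainTheorem5 {C : Type u} [Category.{v} C] [KanInjectivity.OrderEnriched C]
    (E M : MorphismProperty C) (hC : KanInjectivity.IsLocallyRanked E M)
    (H : MorphismProperty C) (hH : MorphismProperty.IsSmall.{v} H) :
    ∃ H' : MorphismProperty C, KanInjectivity.wLInj H = KanInjectivity.LInj H' := by
  refine ⟨kanClosure (wLInj H), ?_⟩
  choose Z hZ hext using exists_extension_mem hC H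
  have hr (X) : kanClosure (wLInj H) (Z X).unit := (Z X).kanClosure_unit
  have hobj {X : C} (hX : (LInj (kanClosure (wLInj H))).obj X) : (wLInj H).obj X := by
    intro A A' h hh f
    obtain ⟨ρ, -, hρ⟩ := hX _ (hr X) (𝟙 X)
    obtain ⟨l, hl⟩ := hZ X h hh (f ≫ (Z X).unit)
    exact ⟨_, hl.of_retract hρ⟩
  refine Subcategory.ext (funext fun X => propext ⟨fun hX A A' h hh => hh.1 X hX, hobj⟩) ?_
  refine MorphismProperty.ext _ _ fun X Y p => ⟨fun hp A A' h hh => hh.2 p hp, fun hp => ?_⟩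
  have hX := (LInj (kanClosure (wLInj H))).source p hp
  have hY := (LInj (kanClosure (wLInj H))).target p hp
  obtain ⟨ρ, hρ, hρ'⟩ := hX _ (hr X) (𝟙 X)
  obtain ⟨σ, -, hσ⟩ := hY _ (hr Y) (𝟙 Y)
  -- The lift `P` of `p` to the extensions commutes with the retractions.
  let t : Test (wLInj H) X := ⟨(Z Y).pt, hZ Y, p ≫ (Z Y).unit⟩
  let P : (Z X).pt ⟶ (Z Y).pt := (Z X).ext t
  have hP : (Z X).unit ≫ P = p ≫ (Z Y).unit := (Z X).fac t
  have hρp : IsLan (Z X).unit (𝟙 X ≫ p) (ρ ≫ p) := (hp _ (hr X)).2.2 _ _ hρ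
  have hPσ : P ≫ σ = ρ ≫ p := by
    refine le_antisymm ?_ (hρp.2 _ ?_)
    · have h : P ≤ ρ ≫ p ≫ (Z Y).unit := (Z X).ext_le t _ (by
        rw [← Category.assoc, hρ', Category.id_comp])
      simpa only [Category.assoc, hσ, Category.comp_id] using comp_le_comp_right h σ
    · rw [← Category.assoc, hP, Category.assoc, hσ, Category.id_comp, Category.comp_id]
  intro A A' h hh
  refine ⟨hobj hX h hh, hobj hY h hh, fun f l hl => ?_⟩
  obtain ⟨k, hk⟩ := hZ X h hh (f ≫ (Z X).unit)
  have hkP := (hext X t h hh).2.2 _ _ hk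
  rw [hl.eq (hk.of_retract hρ'), Category.assoc, ← hPσ, ← Category.assoc]
  refine IsLan.of_retract hσ ?_
  have e : (f ≫ (Z X).unit) ≫ P = (f ≫ p) ≫ (Z Y).unit := by
    rw [Category.assoc, hP, Category.assoc]
  rwa [← e]
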